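/- Let $\mathcal A$ be a finite set and $T$ the left shift on $\mathcal A^{\mathbb N}$, $\mathbb N=\{1,2,\dots\}$. Let $\Omega\subseteq\mathcal A^{\mathbb N}$ be a minimal aperiodic shift (nonempty, closed, $T$-invariant, every $T$-orbit dense in $\Omega$, no $T$-periodic point). Let $\mathcal L$ be its language, i.e. the set of finite words occurring in points of $\Omega$, $\mathcal L(n)$ the set of its words of length $n$, and $p(n)=\#\mathcal L(n)$. Suppose $\Omega$ has constant complexity growth $K\in\mathbb N$: there are $N_0\in\mathbb N$ and an integer $C$ with $p(n)=Kn+C$ for all $n\ge N_0$. Let $\mathcal E(\Omega)$ be the set of ergodic $T$-invariant Borel probability measures on $\Omega$, extended by $0$ to $\mathcal A^{\mathbb N}$. For words $u,w$ let $\#_u(w)$ be the number of occurrences of $u$ in $w$, and let $[u]$ be the set of $x\in\mathcal A^{\mathbb N}$ with prefix $u$. *Special Rauzy graphs.* A word $w\in\mathcal L(n)$ is left (right) special if $aw\in\mathcal L$ (respectively $wa\in\mathcal L$) for at least two letters $a$, special if it is left or right special, and bispecial if it is both. The Rauzy graph $\Gamma(n)$ has vertex set $\mathcal L(n)$ and an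 edge $u\to v$ whenever some $z\in\mathcal L(n+1)$ has prefix $u$ and suffix $v$. The special Rauzy graph $\Gamma^{\mathrm{Spec}}(n)$ is the directed multigraph with one vertex $w$ for each special $w\in\mathcal L(n)$ that is not bispecial and two vertices $w_\ell,w_r$ for each bispecial $w\in\mathcal L(n)$. It has one edge for each path of positive length in $\Gamma(n)$ from a special word to a special word with only non-special words in between; this edge goes from the vertex of the first word to the vertex of the last word, where $w_r$ is used if the first word $w$ is bispecial and $w_\ell$ if the last word $w$ is bispecial. In addition it has one edge $w_\ell\to w_r$ for each bispecial $w$. *Fixed data.* Fix an infinite set $\mathcal J\subseteq\mathbb N$ such that the number $K_\ell$ of left special words and the number $K_r$ of right special words of length $n$ do not depend on $n\in\mathcal J$. Fix a directed multigraph $\Lambda$ and, for each $n\in\mathcal J$, an isomorphism $\Lambda\to\Gamma^{\mathrm{Spec}}(n)$; for a vertex $w$ of $\Lambda$ let $w^{(n)}\in\mathcal L(n)$ be the word belonging to the image of $w$. Assume that for each vertex $w$ of $\Lambda$ there is a $T$-invariant measure $\mu_w$ with $\mu_w([u])=\lim_{\mathcal J\ni n\to\infty}\#_u(w^{(n)})/n$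 for every word $u$. (Such data always exist.) For each $\nu\in\mathcal E(\Omega)$ fix a point $x^{(\nu)}\in\Omega$ that is generic for $\nu$, i.e. $\lim_{n\to\infty}\#_u(x^{(\nu)}_1\cdots x^{(\nu)}_n)/n=\nu([u])$ for every word $u$. *Coloring.* Put $L=K+1$. For a word $w$ of length $n\ge1$ and $x\in\mathcal A^{\mathbb N}$ let $r_L(w,x,j)=1$ if $w$ begins in $x$ at some position $i$ with $(j-1)Ln<i\le jLn$, and $r_L(w,x,j)=0$ otherwise, and let $\mathcal D_L(w,x)=\limsup_{N\to\infty}\frac1N\sum_{j=1}^N r_L(w,x,j)$. A measure $\nu\in\mathcal E(\Omega)$ *colors* the vertex $w$ of $\Lambda$ if $\limsup_{\mathcal J\ni n\to\infty}\mathcal D_L(w^{(n)},x^{(\nu)})>0$. A vertex is *uncolored* if no $\nu\in\mathcal E(\Omega)$ colors it. **Claim.** If (i) some $\nu\in\mathcal E(\Omega)$ colors more than $4$ vertices of $\Lambda$, or (ii) at least $3$ vertices of $\Lambda$ are uncolored, then $\#\mathcal E(\Omega)\le K-2$. -/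

import Mathlib

open MeasureTheory Filter Topology

namespace SpecialRauzy

universe u v

/-! ## Shifts, words and languages

Positions in sequences are numbered from `0`, so the letter `x_{k+1}` of the mathematical text
is `x k`. Finite words are lists. -/

section Words

variable {A : Type u}

/-- The left shift on one-sided sequences. -/
def shift (x : ℕ → A) : ℕ → A := fun k => x (k + 1)

/-- The word of length `n` that begins at position `i` of `x`. -/
def block (x : ℕ → A) (i n : ℕ) : List A := List.ofFn fun k : Fin n => x (i + k)

/-- The cylinder `[w]` of all sequences that have `w` as a prefix. -/
def cyl (w : List A) : Set (ℕ → A) := {x | block x 0 w.length = w}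

/-- The number of occurrences of the word `z` in the word `w`. -/
noncomputable def occ (z w : List A) : ℕ :=
  Set.ncard {j : ℕ | j + z.length ≤ w.length ∧ (w.drop j).take z.length = z}

/-- The language of `Ω`: all finite words that occur in a point of `Ω`. -/
def language (Ω : Set (ℕ → A)) : Set (List A) :=
  {w | ∃ x ∈ Ω, ∃ i : ℕ, block x i w.length = w}

/-- The words of length `n` in the language of `Ω`. -/
def words (Ω : Set (ℕ → A)) (n : ℕ) : Set (List A) := {w | w ∈ language Ω ∧ w.length = n}

/-- The complexity function of `Ω`. -/
noncomputable def complexity (Ω : Set (ℕ → A)) (n : ℕ) : ℕ := (words Ω n).ncard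

/-- A minimal shift: a nonempty closed shift-invariant set in which each orbit is dense. -/
structure IsMinimalShift [TopologicalSpace A] (Ω : Set (ℕ → A)) : Prop where
  nonempty : Ω.Nonempty
  closed : IsClosed Ω
  invariant : ∀ x ∈ Ω, shift x ∈ Ω
  dense_orbit : ∀ x ∈ Ω, Ω ⊆ closure (Set.range fun k : ℕ => shift^[k] x)

/-- `Ω` is aperiodic: it contains no shift-periodic point. -/
def IsAperiodic (Ω : Set (ℕ → A)) : Prop :=
  ∀ x ∈ Ω, x ∉ Function.periodicPts (shift : (ℕ → A) → ℕ → A)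

/-- Constant complexity growth `K` from `N₀` on: `p(n) = K n + C` for all `n ≥ N₀`. -/
def HasConstantGrowth (Ω : Set (ℕ → A)) (K N₀ : ℕ) : Prop :=
  1 ≤ K ∧ ∃ C : ℤ, ∀ n : ℕ, N₀ ≤ n → (complexity Ω n : ℤ) = K * n + C

/-! ## Special words -/

/-- The left extensions of `w` in the language. -/
def leftExt (Ω : Set (ℕ → A)) (w : List A) : Set (List A) :=
  {w' | w' ∈ words Ω (w.length + 1) ∧ w'.tail = w}

/-- The right extensions of `w` in the language. -/
def rightExt (Ω : Set (ℕ → A)) (w : List A) : Set (List A) :=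
  {w' | w' ∈ words Ω (w.length + 1) ∧ w'.dropLast = w}

/-- The left special words of length `n`. -/
def leftSpecial (Ω : Set (ℕ → A)) (n : ℕ) : Set (List A) :=
  {w | w ∈ words Ω n ∧ 2 ≤ (leftExt Ω w).encard}

/-- The right special words of length `n`. -/
def rightSpecial (Ω : Set (ℕ → A)) (n : ℕ) : Set (List A) :=
  {w | w ∈ words Ω n ∧ 2 ≤ (rightExt Ω w).encard}

end Words

/-! ## Directed multigraphs and special Rauzy graphs -/

/-- A directed multigraph (parallel edges and loops are allowed). -/
structure Multidigraph where
  V : Type u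
  E : Type u
  src : E → V
  tgt : E → V

/-- An isomorphism of directed multigraphs. -/
structure Multidigraph.Iso (G : Multidigraph.{u}) (H : Multidigraph.{v}) where
  vert : G.V ≃ H.V
  edge : G.E ≃ H.E
  src_comm : ∀ e, H.src (edge e) = vert (G.src e)
  tgt_comm : ∀ e, H.tgt (edge e) = vert (G.tgt e)

section Graphs

variable {A : Type u}

/-- The edge relation of the Rauzy graph `Γ(n)`, whose vertices are the words of length `n`. -/
def RauzyAdj (Ω : Set (ℕ → A)) (n : ℕ) (w w' : List A) : Prop :=
  ∃ z ∈ words Ω (n + 1), z.dropLast = w ∧ z.tail = w'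

/-- A path of positive length in the Rauzy graph `Γ(n)` from a special word to a special word
that visits only non-special words in between. -/
structure SpecialPath (Ω : Set (ℕ → A)) (n : ℕ) where
  start : List A
  mid : List (List A)
  finish : List A
  chain : List.IsChain (RauzyAdj Ω n) (start :: (mid ++ [finish]))
  start_special : start ∈ leftSpecial Ω n ∪ rightSpecial Ω n
  finish_special : finish ∈ leftSpecial Ω n ∪ rightSpecial Ω n
  mid_not_special : ∀ w ∈ mid, w ∉ leftSpecial Ω n ∪ rightSpecial Ω n

/-- The vertices of the special Rauzy graph: one for each left special word (left summand) and
one for each right special word (right summand). So a unispecial word gives one vertex, and a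
bispecial word `w` gives the two vertices `w_ℓ = inl w` and `w_r = inr w`. -/
abbrev SpecialVertex (Ω : Set (ℕ → A)) (n : ℕ) : Type u :=
  {w : List A // w ∈ leftSpecial Ω n} ⊕ {w : List A // w ∈ rightSpecial Ω n}

/-- The word to which a vertex belongs. -/
def SpecialVertex.word {Ω : Set (ℕ → A)} {n : ℕ} (p : SpecialVertex Ω n) : List A :=
  Sum.elim Subtype.val Subtype.val p

open Classical in
/-- The vertex at which the edge of a path begins: `w_r` if the path begins at a bispecial
word `w`, and the only vertex of its first word otherwise. -/
noncomputable def SpecialPath.srcVertex {Ω : Set (ℕ → A)} {n : ℕ} (p : SpecialPath Ω n) :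
    SpecialVertex Ω n :=
  if h : p.start ∈ rightSpecial Ω n then Sum.inr ⟨p.start, h⟩
  else Sum.inl ⟨p.start, p.start_special.resolve_right h⟩

open Classical in
/-- The vertex at which the edge of a path ends: `w_ℓ` if the path ends at a bispecial
word `w`, and the only vertex of its last word otherwise. -/
noncomputable def SpecialPath.tgtVertex {Ω : Set (ℕ → A)} {n : ℕ} (p : SpecialPath Ω n) :
    SpecialVertex Ω n :=
  if h : p.finish ∈ leftSpecial Ω n then Sum.inl ⟨p.finish, h⟩
  else Sum.inr ⟨p.finish, p.finish_special.resolve_left h⟩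

/-- The (unweighted) special Rauzy graph of words of length `n`: one edge for each special path,
and one edge `w_ℓ → w_r` for each bispecial word `w`. -/
noncomputable def specialRauzyGraph (Ω : Set (ℕ → A)) (n : ℕ) : Multidigraph.{u} where
  V := SpecialVertex Ω n
  E := SpecialPath Ω n ⊕ {w : List A // w ∈ leftSpecial Ω n ∩ rightSpecial Ω n}
  src := Sum.elim SpecialPath.srcVertex fun w => Sum.inl ⟨w.1, w.2.1⟩
  tgt := Sum.elim SpecialPath.tgtVertex fun w => Sum.inr ⟨w.1, w.2.2⟩

end Graphs

/-! ## Invariant measures, generic points, words that generate a measure -/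

section Measures

variable {A : Type u} [MeasurableSpace A]

/-- The shift-invariant probability measures of `Ω`, extended by `0` to all sequences. -/
def invariantMeasures (Ω : Set (ℕ → A)) : Set (Measure (ℕ → A)) :=
  {μ | IsProbabilityMeasure μ ∧ μ Ωᶜ = 0 ∧ MeasurePreserving shift μ μ}

/-- The ergodic shift-invariant probability measures of `Ω`. -/
def ergodicMeasures (Ω : Set (ℕ → A)) : Set (Measure (ℕ → A)) :=
  {μ | μ ∈ invariantMeasures Ω ∧ Ergodic shift μ}

/-- `x` is generic for `ν`: each word occurs in `x` with frequency the measure of its cylinder. -/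
def IsGeneric (x : ℕ → A) (ν : Measure (ℕ → A)) : Prop :=
  ∀ z : List A,
    Tendsto (fun n : ℕ => (occ z (block x 0 n) : ℝ) / n) atTop (𝓝 (ν.real (cyl z)))

/-- The words `w i` generate the measure `μ` along `l`: `μ` is the shift-invariant measure such
that `μ [z]` is the limit of the frequencies of `z` in `w i`, for each word `z`. -/
def Generates {ι : Type*} (l : Filter ι) (w : ι → List A) (μ : Measure (ℕ → A)) : Prop :=
  MeasurePreserving shift μ μ ∧
    ∀ z : List A,
      Tendsto (fun i => (occ z (w i) : ℝ) / (w i).length) l (𝓝 (μ.real (cyl z)))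

end Measures

/-! ## Disjoint density -/

section Density

variable {A : Type u}

open Classical in
/-- `1` if `w` begins in the block of indices `j L |w|, …, (j + 1) L |w| - 1` of `x`, and `0`
otherwise (blocks are numbered from `0` here). -/
noncomputable def blockIndicator (L : ℕ) (w : List A) (x : ℕ → A) (j : ℕ) : ℝ :=
  if ∃ i : ℕ, j * (L * w.length) ≤ i ∧ i < (j + 1) * (L * w.length) ∧ block x i w.length = w
  then 1 else 0

/-- The disjoint upper density of `w` in `x` by `L`-blocks. -/
noncomputable def density (L : ℕ) (w : List A) (x : ℕ → A) : ℝ :=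
  limsup (fun N : ℕ => (∑ j ∈ Finset.range N, blockIndicator L w x j) / (N : ℝ)) atTop

end Density

/-! ## Colorings -/

section Coloring

variable {A : Type u} [MeasurableSpace A]

/-- The fixed data with respect to which vertices are colored: an infinite set `J` of lengths
along which the numbers of left and right special words are constant, a graph `Λ` to which all
special Rauzy graphs with `n ∈ J` are isomorphic, by a fixed naming of the vertices, and for each
vertex `w` of `Λ` a measure `μ w` that is generated by the words named `w`. -/
structure ColoringData (Ω : Set (ℕ → A)) where
  J : Set ℕ
  J_pos : ∀ n ∈ J, 1 ≤ n
  J_infinite : J.Infinite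
  Kl : ℕ
  Kr : ℕ
  card_left : ∀ n ∈ J, (leftSpecial Ω n).encard = Kl
  card_right : ∀ n ∈ J, (rightSpecial Ω n).encard = Kr
  Λ : Multidigraph.{v}
  iso : ∀ n : J, Λ.Iso (specialRauzyGraph Ω n)
  μ : Λ.V → Measure (ℕ → A)
  generates : ∀ w : Λ.V,
    Generates atTop (fun n : J => SpecialVertex.word ((iso n).vert w)) (μ w)

namespace ColoringData

variable {Ω : Set (ℕ → A)} (S : ColoringData.{u, v} Ω)

/-- The word `w^(n)` of length `n ∈ J` named by the vertex `w` of `Λ`. -/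
def wordAt (w : S.Λ.V) (n : S.J) : List A := SpecialVertex.word ((S.iso n).vert w)

/-- The disjoint upper `L`-density of `μ_w` in the measure whose fixed generic point is `x`: the
upper limit of the densities of `w^(n)` in `x`, as `n → ∞` in `J`. -/
noncomputable def vertexDensity (L : ℕ) (w : S.Λ.V) (x : ℕ → A) : ℝ :=
  limsup (fun n : S.J => density L (S.wordAt w n) x) atTop

/-- The vertices colored by `ν`, when `x ν` is the fixed generic point for `ν`. -/
def colorClass (L : ℕ) (x : Measure (ℕ → A) → ℕ → A) (ν : Measure (ℕ → A)) : Set S.Λ.V :=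
  {w | 0 < S.vertexDensity L w (x ν)}

/-- The vertices that no ergodic measure colors. -/
def uncolored (L : ℕ) (x : Measure (ℕ → A) → ℕ → A) : Set S.Λ.V :=
  {w | ∀ ν ∈ ergodicMeasures Ω, w ∉ S.colorClass L x ν}

end ColoringData

end Coloring

end SpecialRauzy

open SpecialRauzy

namespace SpecialRauzy

universe u v

/-! ### Blocks of a point, special words and recurrence -/

section Words

variable {A : Type u}

/-! The theorem is a count of the vertices of Λ. There are at most 2K of them, because p(n+1) - p(n)
= K bounds the number of left special words and the number of right special words
(`finite_and_card_vertices_le`).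

Color classes are disjoint. If ν colors w, then a positive proportion of the blocks of a ν-generic
point see w^(n), for infinitely many n. Occurrences in different blocks overlap boundedly often, so
every word frequency of w^(n) is at most a constant times its ν-measure. Hence μ_w ≤ c ν, and
ergodicity gives μ_w = ν (`Generates.eq_of_frequently_lt_density`).

Each ergodic measure colors at least two vertices. A block of Ln positions, L = K + 1, has more
positions than there are words of length n, so it meets both a left and a right special word.
Pigeonhole over the finitely many vertices then finds one vertex of each kind with density bounded
below (`two_le_encard_colorClass`).

So 2 #E ≤ 2K, and in either case of the hypothesis there are at least 3 surplus vertices. By parity,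
#E ≤ K - 2. -/

@[simp]
lemma length_block (x : ℕ → A) (i n : ℕ) : (block x i n).length = n := by
  simp [block]

lemma block_eq_iff {x y : ℕ → A} {i j n : ℕ} :
    block x i n = block y j n ↔ ∀ k < n, x (i + k) = y (j + k) := by
  simp only [block, List.ofFn_inj, funext_iff, Fin.forall_iff]

lemma take_drop_block (x : ℕ → A) {i j m n : ℕ} (h : j + m ≤ n) :
    ((block x i n).drop j).take m = block x (i + j) m := by
  apply List.ext_getElem
  · simp only [List.length_take, List.length_drop, length_block]; omega
  · intro k h₁ h₂
    simp [block, Nat.add_assoc]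

lemma tail_block (x : ℕ → A) (i n : ℕ) : (block x i (n + 1)).tail = block x (i + 1) n := by
  have h := take_drop_block x (i := i) (j := 1) (m := n) (n := n + 1) (by omega)
  rw [List.drop_one, List.take_of_length_le (by simp)] at h
  exact h

lemma dropLast_block (x : ℕ → A) (i n : ℕ) : (block x i (n + 1)).dropLast = block x i n := by
  have h := take_drop_block x (i := i) (j := 0) (m := n) (n := n + 1) (by omega)
  rw [List.drop_zero] at h
  rw [List.dropLast_eq_take, length_block, Nat.add_sub_cancel, h, Nat.add_zero]

lemma iterate_shift_apply (x : ℕ → A) (m k : ℕ) : (shift^[m] x) k = x (m + k) := by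
  induction m generalizing x with
  | zero => simp
  | succ m ih => rw [Function.iterate_succ_apply, ih, shift]; congr 1; omega

lemma block_iterate_shift (x : ℕ → A) (m i n : ℕ) :
    block (shift^[m] x) i n = block x (m + i) n := by
  rw [block_eq_iff]
  intro k _
  rw [iterate_shift_apply, Nat.add_assoc]

lemma mem_words_iff {Ω : Set (ℕ → A)} {n : ℕ} {w : List A} :
    w ∈ words Ω n ↔ ∃ x ∈ Ω, ∃ i, block x i n = w := by
  constructor
  · rintro ⟨⟨x, hx, i, h⟩, rfl⟩
    exact ⟨x, hx, i, h⟩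
  · rintro ⟨x, hx, i, rfl⟩
    exact ⟨⟨x, hx, i, by rw [length_block]⟩, length_block x i n⟩

lemma block_mem_words {Ω : Set (ℕ → A)} {x : ℕ → A} (hx : x ∈ Ω) (i n : ℕ) :
    block x i n ∈ words Ω n :=
  mem_words_iff.2 ⟨x, hx, i, rfl⟩

lemma finite_words [Finite A] (Ω : Set (ℕ → A)) (n : ℕ) : (words Ω n).Finite :=
  (List.finite_length_eq A n).subset fun _ hw => hw.2

lemma mem_leftSpecial_iff {Ω : Set (ℕ → A)} {n : ℕ} {w : List A} :
    w ∈ leftSpecial Ω n ↔ w ∈ words Ω n ∧ 2 ≤ {z | z ∈ words Ω (n + 1) ∧ z.tail = w}.encard := by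
  refine and_congr_right fun hw => ?_
  rw [leftExt, hw.2]

lemma mem_rightSpecial_iff {Ω : Set (ℕ → A)} {n : ℕ} {w : List A} :
    w ∈ rightSpecial Ω n ↔
      w ∈ words Ω n ∧ 2 ≤ {z | z ∈ words Ω (n + 1) ∧ z.dropLast = w}.encard := by
  refine and_congr_right fun hw => ?_
  rw [rightExt, hw.2]

lemma two_le_encard {α : Type*} {s : Set α} {a b : α} (ha : a ∈ s) (hb : b ∈ s) (hab : a ≠ b) :
    2 ≤ s.encard := by
  rw [← Set.encard_pair hab]
  exact Set.encard_le_encard (Set.pair_subset ha hb)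

/-- A word that is not right special determines the next word. -/
lemma block_succ_eq {Ω : Set (ℕ → A)} {x : ℕ → A} (hx : x ∈ Ω) {i j n : ℕ}
    (h : block x i n = block x j n) (hn : block x i n ∉ rightSpecial Ω n) :
    block x (i + 1) n = block x (j + 1) n := by
  rw [← tail_block, ← tail_block]
  by_contra hne
  refine hn (mem_rightSpecial_iff.2 ⟨block_mem_words hx i n, ?_⟩)
  exact two_le_encard ⟨block_mem_words hx i _, dropLast_block x i n⟩
    ⟨block_mem_words hx j _, (dropLast_block x j n).trans h.symm⟩ fun e => hne (by rw [e])

/-- A word that is not left special determines the preceding word. -/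
lemma block_pred_eq {Ω : Set (ℕ → A)} {x : ℕ → A} (hx : x ∈ Ω) {i j n : ℕ}
    (h : block x (i + 1) n = block x (j + 1) n) (hn : block x (i + 1) n ∉ leftSpecial Ω n) :
    block x i n = block x j n := by
  rw [← dropLast_block x i n, ← dropLast_block x j n]
  by_contra hne
  refine hn (mem_leftSpecial_iff.2 ⟨block_mem_words hx (i + 1) n, ?_⟩)
  exact two_le_encard ⟨block_mem_words hx i _, tail_block x i n⟩
    ⟨block_mem_words hx j _, (tail_block x j n).trans h.symm⟩ fun e => hne (by rw [e])

lemma iterate_shift_mem [TopologicalSpace A] {Ω : Set (ℕ → A)} (hΩ : IsMinimalShift Ω)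
    {x : ℕ → A} (hx : x ∈ Ω) (m : ℕ) : shift^[m] x ∈ Ω := by
  induction m with
  | zero => exact hx
  | succ m ih => rw [Function.iterate_succ_apply']; exact hΩ.invariant _ ih

lemma isOpen_setOf_block_eq [TopologicalSpace A] [DiscreteTopology A] (n : ℕ) (w : List A) :
    IsOpen {x : ℕ → A | block x 0 n = w} := by
  rw [isOpen_iff_mem_nhds]
  intro x hx
  have : ∀ᶠ y in 𝓝 x, ∀ k ∈ Finset.range n, y k = x k := by
    rw [Filter.eventually_all_finset]
    intro k _
    exact (continuous_apply k).continuousAt.eventually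
      ((isOpen_discrete {x k}).mem_nhds rfl)
  filter_upwards [this] with y hy
  rw [← hx.out]
  show block y 0 n = block x 0 n
  rw [block_eq_iff]
  intro k hk
  simpa using hy k (Finset.mem_range.2 hk)

/-- In a minimal shift each word of the language recurs in each point. -/
lemma exists_block_eq [TopologicalSpace A] [DiscreteTopology A] {Ω : Set (ℕ → A)}
    (hΩ : IsMinimalShift Ω) {x : ℕ → A} (hx : x ∈ Ω) {n : ℕ} {w : List A} (hw : w ∈ words Ω n)
    (m : ℕ) : ∃ k, m ≤ k ∧ block x k n = w := by
  obtain ⟨y, hy, i, rfl⟩ := mem_words_iff.1 hw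
  -- Starting from the `m`-th shift of `x` forces the occurrence found to lie at a position at least
  -- `m`.
  have hcl := hΩ.dense_orbit _ (iterate_shift_mem hΩ hx m) (iterate_shift_mem hΩ hy i)
  obtain ⟨z, hz, k, rfl⟩ := mem_closure_iff.1 hcl _ (isOpen_setOf_block_eq n (block y i n))
    (by show block _ 0 n = _; rw [block_iterate_shift, Nat.add_zero])
  refine ⟨m + k, by omega, ?_⟩
  have hz' : block (shift^[k] (shift^[m] x)) 0 n = block y i n := hz
  rwa [block_iterate_shift, block_iterate_shift, Nat.add_zero] at hz'

lemma mapsTo_tail_words {Ω : Set (ℕ → A)} {n : ℕ} :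
    Set.MapsTo List.tail (words Ω (n + 1)) (words Ω n) := by
  intro w hw
  obtain ⟨x, hx, i, rfl⟩ := mem_words_iff.1 hw
  rw [tail_block]
  exact block_mem_words hx _ _

lemma mapsTo_dropLast_words {Ω : Set (ℕ → A)} {n : ℕ} :
    Set.MapsTo List.dropLast (words Ω (n + 1)) (words Ω n) := by
  intro w hw
  obtain ⟨x, hx, i, rfl⟩ := mem_words_iff.1 hw
  rw [dropLast_block]
  exact block_mem_words hx _ _

/-- Points are one-sided, so an occurrence at position 0 has no left extension; minimality supplies
a later one. -/
lemma surjOn_tail_words [TopologicalSpace A] [DiscreteTopology A] {Ω : Set (ℕ → A)}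
    (hΩ : IsMinimalShift Ω) {n : ℕ} : Set.SurjOn List.tail (words Ω (n + 1)) (words Ω n) := by
  intro w hw
  obtain ⟨x, hx⟩ := hΩ.nonempty
  obtain ⟨k, hk, rfl⟩ := exists_block_eq hΩ hx hw 1
  obtain ⟨k, rfl⟩ := Nat.exists_eq_add_of_le' hk
  exact ⟨_, block_mem_words hx k (n + 1), tail_block x k n⟩

lemma surjOn_dropLast_words {Ω : Set (ℕ → A)} {n : ℕ} :
    Set.SurjOn List.dropLast (words Ω (n + 1)) (words Ω n) := by
  intro w hw
  obtain ⟨x, hx, i, rfl⟩ := mem_words_iff.1 hw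
  exact ⟨_, block_mem_words hx i (n + 1), dropLast_block x i n⟩

/-- Every fiber has at least one element, and each large fiber contributes at least one more.
Applied to `List.tail` and `List.dropLast`, this bounds the number of special words by p(n+1) -
p(n). -/
lemma ncard_add_ncard_le {α β : Type*} {f : α → β} {s : Set α} {t : Set β} (hs : s.Finite)
    (hm : Set.MapsTo f s t) (hf : Set.SurjOn f s t) :
    t.ncard + {b | b ∈ t ∧ 2 ≤ {a | a ∈ s ∧ f a = b}.encard}.ncard ≤ s.ncard := by
  classical
  have ht : t.Finite := (hs.image f).subset hf
  lift s to Finset α using hs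
  lift t to Finset β using ht
  have hset : {b | b ∈ (t : Set β) ∧ 2 ≤ {a | a ∈ (s : Set α) ∧ f a = b}.encard} =
      ((t.filter fun b => 2 ≤ (s.filter fun a => f a = b).card : Finset β) : Set β) := by
    ext b
    have : {a | a ∈ (s : Set α) ∧ f a = b} = ((s.filter fun a => f a = b : Finset α) : Set α) := by
      ext a; simp
    rw [Set.mem_ofPred_eq, this, Set.encard_coe_eq_coe_finsetCard, Finset.coe_filter]
    simp
  rw [hset, Set.ncard_coe_finset, Set.ncard_coe_finset, Set.ncard_coe_finset,
    Finset.card_eq_sum_card_fiberwise hm, Finset.card_filter, Finset.card_eq_sum_ones,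
    ← Finset.sum_add_distrib]
  refine Finset.sum_le_sum fun b hb => ?_
  split_ifs with h
  · exact h
  · obtain ⟨a, ha, hab⟩ := hf hb
    exact Finset.card_pos.2 ⟨a, Finset.mem_filter.2 ⟨ha, hab⟩⟩

lemma exists_two_le_encard_fiber {α β : Type*} {f : α → β} {s : Set α} {t : Set β}
    (ht : t.Finite) (hm : Set.MapsTo f s t) (h : t.ncard < s.ncard) :
    ∃ b ∈ t, 2 ≤ {a | a ∈ s ∧ f a = b}.encard := by
  obtain ⟨a, ha, b, hb, hab, he⟩ := Set.exists_ne_map_eq_of_ncard_lt_of_maps_to h hm ht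
  exact ⟨f b, hm hb, two_le_encard ⟨ha, he⟩ ⟨hb, rfl⟩ hab⟩

/-! ### Consequences of constant growth: few special words, but some in every window -/

section Growth

variable {Ω : Set (ℕ → A)} {K N₀ n : ℕ}

lemma HasConstantGrowth.complexity_succ (hK : HasConstantGrowth Ω K N₀) (hn : N₀ ≤ n) :
    complexity Ω (n + 1) = complexity Ω n + K := by
  obtain ⟨-, C, hC⟩ := hK
  have h₁ := hC n hn
  have h₂ := hC (n + 1) (by omega)
  push_cast at h₂
  have : (complexity Ω (n + 1) : ℤ) = complexity Ω n + K := by rw [h₁, h₂]; ring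
  exact_mod_cast this

/-- This is why L = K + 1: once n > C, a block of Ln positions has more positions than there are
words of length n. -/
lemma HasConstantGrowth.eventually_complexity_lt (hK : HasConstantGrowth Ω K N₀) :
    ∀ᶠ n in atTop, complexity Ω n < (K + 1) * n := by
  obtain ⟨-, C, hC⟩ := hK
  filter_upwards [eventually_ge_atTop N₀, eventually_gt_atTop C.toNat] with n h₁ h₂
  have h₃ := hC n h₁
  have h₄ : C < n := by omega
  have : (complexity Ω n : ℤ) < ((K + 1) * n : ℕ) := by push_cast; rw [h₃]; linarith
  exact_mod_cast this

lemma HasConstantGrowth.ncard_lt (hK : HasConstantGrowth Ω K N₀) (hn : N₀ ≤ n) :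
    (words Ω n).ncard < (words Ω (n + 1)).ncard := by
  have h₁ := hK.complexity_succ hn
  have h₂ := hK.1
  unfold complexity at h₁
  omega

variable [Finite A]

lemma HasConstantGrowth.leftSpecial_nonempty (hK : HasConstantGrowth Ω K N₀) (hn : N₀ ≤ n) :
    (leftSpecial Ω n).Nonempty := by
  obtain ⟨w, hw, h⟩ := exists_two_le_encard_fiber (finite_words Ω n)
    mapsTo_tail_words (hK.ncard_lt hn)
  exact ⟨w, mem_leftSpecial_iff.2 ⟨hw, h⟩⟩

lemma HasConstantGrowth.rightSpecial_nonempty (hK : HasConstantGrowth Ω K N₀) (hn : N₀ ≤ n) :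
    (rightSpecial Ω n).Nonempty := by
  obtain ⟨w, hw, h⟩ := exists_two_le_encard_fiber (finite_words Ω n)
    mapsTo_dropLast_words (hK.ncard_lt hn)
  exact ⟨w, mem_rightSpecial_iff.2 ⟨hw, h⟩⟩

lemma finite_leftSpecial (Ω : Set (ℕ → A)) (n : ℕ) : (leftSpecial Ω n).Finite :=
  (finite_words Ω n).subset fun _ hw => hw.1

lemma finite_rightSpecial (Ω : Set (ℕ → A)) (n : ℕ) : (rightSpecial Ω n).Finite :=
  (finite_words Ω n).subset fun _ hw => hw.1

lemma HasConstantGrowth.ncard_leftSpecial_le [TopologicalSpace A] [DiscreteTopology A]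
    (hK : HasConstantGrowth Ω K N₀) (hΩ : IsMinimalShift Ω) (hn : N₀ ≤ n) :
    (leftSpecial Ω n).ncard ≤ K := by
  have h₁ := hK.complexity_succ hn
  have h₂ := ncard_add_ncard_le (finite_words Ω (n + 1)) mapsTo_tail_words (surjOn_tail_words hΩ)
  unfold complexity at h₁
  have : leftSpecial Ω n =
      {w | w ∈ words Ω n ∧ 2 ≤ {z | z ∈ words Ω (n + 1) ∧ z.tail = w}.encard} :=
    Set.ext fun _ => mem_leftSpecial_iff
  rw [this]
  omega

lemma HasConstantGrowth.ncard_rightSpecial_le (hK : HasConstantGrowth Ω K N₀) (hn : N₀ ≤ n) :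
    (rightSpecial Ω n).ncard ≤ K := by
  have h₁ := hK.complexity_succ hn
  have h₂ := ncard_add_ncard_le (finite_words Ω (n + 1)) mapsTo_dropLast_words
    surjOn_dropLast_words
  unfold complexity at h₁
  have : rightSpecial Ω n =
      {w | w ∈ words Ω n ∧ 2 ≤ {z | z ∈ words Ω (n + 1) ∧ z.dropLast = w}.encard} :=
    Set.ext fun _ => mem_rightSpecial_iff
  rw [this]
  omega

lemma exists_repeated_block {x : ℕ → A} (hx : x ∈ Ω) {m D : ℕ} (hD : complexity Ω n < D) :
    ∃ i j, m ≤ i ∧ i < j ∧ j < m + D ∧ block x i n = block x j n := by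
  have hcard : (words Ω n).ncard < ((Finset.Ico m (m + D) : Finset ℕ) : Set ℕ).ncard := by
    rw [Set.ncard_coe_finset, Nat.card_Ico]
    unfold complexity at hD
    omega
  obtain ⟨i, hi, j, hj, hij, h⟩ := Set.exists_ne_map_eq_of_ncard_lt_of_maps_to
    (f := fun i => block x i n) hcard (fun i _ => block_mem_words hx i n) (finite_words Ω n)
  simp only [Finset.coe_Ico, Set.mem_Ico] at hi hj
  rcases Nat.lt_or_gt_of_ne hij with hlt | hlt
  · exact ⟨i, j, hi.1, hlt, hj.2, h⟩
  · exact ⟨j, i, hj.1, hlt, hi.2, h.symm⟩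

variable [TopologicalSpace A] [DiscreteTopology A]

/-- A window with more positions than there are words of length `n` contains a right special
word. -/
lemma exists_block_mem_rightSpecial (hΩ : IsMinimalShift Ω) {x : ℕ → A} (hx : x ∈ Ω)
    (hne : (rightSpecial Ω n).Nonempty) {D : ℕ} (hD : complexity Ω n < D) (m : ℕ) :
    ∃ i, m ≤ i ∧ i < m + D ∧ block x i n ∈ rightSpecial Ω n := by
  by_contra! hcon
  obtain ⟨i, j, hmi, hij, hjm, he⟩ := exists_repeated_block hx (m := m) hD
  -- Without right special words in the window, the words at positions `i` to `j` close up into a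
  -- cycle that cannot be left. A right special word recurs after `i`, so it would lie on this
  -- cycle.
  have key : ∀ k, i ≤ k → ∃ c, i ≤ c ∧ c < j ∧ block x k n = block x c n := by
    intro k hk
    induction k, hk using Nat.le_induction with
    | base => exact ⟨i, le_rfl, hij, rfl⟩
    | succ k _ ih =>
      obtain ⟨c, hic, hcj, h⟩ := ih
      have h' := block_succ_eq hx h (h ▸ hcon c (by omega) (by omega))
      rcases Nat.lt_or_ge (c + 1) j with hlt | hge
      · exact ⟨c + 1, by omega, hlt, h'⟩
      · have : c + 1 = j := by omega
        exact ⟨i, le_rfl, hij, by rw [h', this, he]⟩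
  obtain ⟨w, hw⟩ := hne
  obtain ⟨k, hk, rfl⟩ := exists_block_eq hΩ hx hw.1 i
  obtain ⟨c, hic, hcj, h⟩ := key k hk
  exact hcon c (by omega) (by omega) (h ▸ hw)

/-- A window with more positions than there are words of length `n` contains a left special
word. -/
lemma exists_block_mem_leftSpecial (hΩ : IsMinimalShift Ω) {x : ℕ → A} (hx : x ∈ Ω)
    (hne : (leftSpecial Ω n).Nonempty) {D : ℕ} (hD : complexity Ω n < D) (m : ℕ) :
    ∃ i, m ≤ i ∧ i < m + D ∧ block x i n ∈ leftSpecial Ω n := by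
  by_contra! hcon
  obtain ⟨i, j, hmi, hij, hjm, he⟩ := exists_repeated_block hx (m := m) hD
  obtain ⟨w, hw⟩ := hne
  -- The cycle is now traversed backwards. This needs a starting point to the right: `l` is an
  -- occurrence of the repeated word after an occurrence `k` of a left special word, and the walk
  -- runs from `l` down to `k`.
  obtain ⟨k, -, rfl⟩ := exists_block_eq hΩ hx hw.1 0
  obtain ⟨l, hl, hlj⟩ := exists_block_eq hΩ hx (block_mem_words hx j n) k
  have key : ∀ d, d ≤ l → ∃ c, i < c ∧ c ≤ j ∧ block x (l - d) n = block x c n := by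
    intro d
    induction d with
    | zero => exact fun _ => ⟨j, hij, le_rfl, hlj⟩
    | succ d ih =>
      intro hd
      obtain ⟨c, hic, hcj, h⟩ := ih (by omega)
      obtain ⟨c, rfl⟩ := Nat.exists_eq_add_of_lt hic
      have e : l - d = l - (d + 1) + 1 := by omega
      rw [e] at h
      have h' := block_pred_eq hx h (h ▸ hcon _ (by omega) (by omega))
      rcases Nat.eq_zero_or_pos c with rfl | hc
      · exact ⟨j, hij, le_rfl, by rw [h', Nat.add_zero, he]⟩
      · exact ⟨i + c, by omega, by omega, h'⟩
  obtain ⟨c, hic, hcj, h⟩ := key (l - k) (by omega)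
  rw [Nat.sub_sub_self hl] at h
  exact hcon c (by omega) (by omega) (h ▸ hw)

end Growth

end Words

/-! ### Block densities compared with word frequencies -/

section Density

variable {A : Type u}

open Classical in
lemma occ_block (z : List A) (x : ℕ → A) (i n : ℕ) :
    occ z (block x i n) =
      ((Finset.range (n + 1)).filter fun p =>
        p + z.length ≤ n ∧ block x (i + p) z.length = z).card := by
  rw [occ, ← Set.ncard_coe_finset]
  congr 1
  ext p
  simp only [length_block, Finset.coe_filter, Finset.mem_range, Set.mem_ofPred_eq]
  constructor
  · rintro ⟨h₁, h₂⟩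
    rw [take_drop_block x h₁] at h₂
    exact ⟨by omega, h₁, h₂⟩
  · rintro ⟨-, h₁, h₂⟩
    exact ⟨h₁, by rw [take_drop_block x h₁, h₂]⟩

lemma occ_nil (w : List A) : occ [] w = w.length + 1 := by
  have : {j : ℕ | j + ([] : List A).length ≤ w.length ∧
      (w.drop j).take ([] : List A).length = []} = (Finset.range (w.length + 1) : Finset ℕ) := by
    ext j
    simp
  rw [occ, this, Set.ncard_coe_finset, Finset.card_range]

lemma blockIndicator_nonneg (L : ℕ) (w : List A) (x : ℕ → A) (j : ℕ) :
    0 ≤ blockIndicator L w x j := by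
  unfold blockIndicator
  split_ifs <;> norm_num

lemma blockIndicator_le_one (L : ℕ) (w : List A) (x : ℕ → A) (j : ℕ) :
    blockIndicator L w x j ≤ 1 := by
  unfold blockIndicator
  split_ifs <;> norm_num

lemma sum_blockIndicator_div_nonneg (L : ℕ) (w : List A) (x : ℕ → A) (N : ℕ) :
    0 ≤ (∑ j ∈ Finset.range N, blockIndicator L w x j) / (N : ℝ) :=
  div_nonneg (Finset.sum_nonneg fun j _ => blockIndicator_nonneg L w x j) N.cast_nonneg

lemma sum_blockIndicator_div_le_one (L : ℕ) (w : List A) (x : ℕ → A) (N : ℕ) :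
    (∑ j ∈ Finset.range N, blockIndicator L w x j) / (N : ℝ) ≤ 1 := by
  refine div_le_one_of_le₀ ?_ N.cast_nonneg
  calc _ ≤ ∑ j ∈ Finset.range N, (1 : ℝ) :=
        Finset.sum_le_sum fun j _ => blockIndicator_le_one L w x j
    _ = N := by simp

/-- The limsup of real functions is meaningful only under boundedness conditions; all averages and
densities here lie in [0, 1]. -/
lemma isBoundedUnder_le_of_mem_Icc {ι : Type*} {l : Filter ι} {f : ι → ℝ}
    (h : ∀ i, f i ∈ Set.Icc 0 1) : l.IsBoundedUnder (· ≤ ·) f :=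
  isBoundedUnder_of ⟨1, fun i => (h i).2⟩

lemma isCoboundedUnder_le_of_mem_Icc {ι : Type*} {l : Filter ι} [l.NeBot] {f : ι → ℝ}
    (h : ∀ i, f i ∈ Set.Icc 0 1) : l.IsCoboundedUnder (· ≤ ·) f :=
  (isBoundedUnder_of ⟨0, fun i => (h i).1⟩ : l.IsBoundedUnder (· ≥ ·) f).isCoboundedUnder_le

lemma density_mem_Icc (L : ℕ) (w : List A) (x : ℕ → A) : density L w x ∈ Set.Icc 0 1 := by
  have h : ∀ N : ℕ, (∑ j ∈ Finset.range N, blockIndicator L w x j) / (N : ℝ) ∈ Set.Icc 0 1 :=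
    fun N => ⟨sum_blockIndicator_div_nonneg L w x N, sum_blockIndicator_div_le_one L w x N⟩
  constructor
  · exact le_limsup_of_frequently_le (Frequently.of_forall fun N => (h N).1)
      (isBoundedUnder_le_of_mem_Icc h)
  · exact limsup_le_of_le (isCoboundedUnder_le_of_mem_Icc h) (Eventually.of_forall fun N => (h N).2)

lemma le_density {L : ℕ} {w : List A} {x : ℕ → A} {c : ℝ}
    (h : ∃ᶠ N : ℕ in atTop, c ≤ (∑ j ∈ Finset.range N, blockIndicator L w x j) / (N : ℝ)) :
    c ≤ density L w x :=
  le_limsup_of_frequently_le h (isBoundedUnder_le_of_mem_Icc fun N =>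
    ⟨sum_blockIndicator_div_nonneg L w x N, sum_blockIndicator_div_le_one L w x N⟩)

lemma frequently_lt_of_lt_density {L : ℕ} {w : List A} {x : ℕ → A} {c : ℝ}
    (h : c < density L w x) :
    ∃ᶠ N : ℕ in atTop, c < (∑ j ∈ Finset.range N, blockIndicator L w x j) / (N : ℝ) :=
  frequently_lt_of_lt_limsup (isCoboundedUnder_le_of_mem_Icc fun N =>
    ⟨sum_blockIndicator_div_nonneg L w x N, sum_blockIndicator_div_le_one L w x N⟩) h

/-- Occurrences of `z` inside occurrences of `w` in different blocks coincide at most in pairs. -/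
lemma sum_blockIndicator_mul_occ_le {L : ℕ} (hL : 1 ≤ L) {w : List A} (hw : 1 ≤ w.length)
    (z : List A) (x : ℕ → A) (N : ℕ) :
    (∑ j ∈ Finset.range N, blockIndicator L w x j) * occ z w ≤
      2 * (occ z (block x 0 ((N + 1) * (L * w.length))) : ℝ) := by
  classical
  set n := w.length with hn
  set D := L * n with hD
  have hnD : n ≤ D := Nat.le_mul_of_pos_left n hL
  set H := (Finset.range N).filter fun j =>
    ∃ i : ℕ, j * D ≤ i ∧ i < (j + 1) * D ∧ block x i n = w with hH
  have hsum : ∑ j ∈ Finset.range N, blockIndicator L w x j = H.card := by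
    rw [hH, Finset.card_filter, Nat.cast_sum]
    refine Finset.sum_congr rfl fun j _ => ?_
    simp only [blockIndicator, Nat.cast_ite, Nat.cast_one, Nat.cast_zero, ← hn, ← hD]
  have hex : ∀ j, ∃ i : ℕ, j ∈ H → j * D ≤ i ∧ i < (j + 1) * D ∧ block x i n = w := by
    intro j
    by_cases hj : j ∈ H
    · obtain ⟨i, hi⟩ := (Finset.mem_filter.1 hj).2
      exact ⟨i, fun _ => hi⟩
    · exact ⟨0, fun h => absurd h hj⟩
  choose i hi using hex
  set O := (Finset.range (n + 1)).filter fun p =>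
    p + z.length ≤ n ∧ (w.drop p).take z.length = z with hO
  have hocc : occ z w = O.card := by
    rw [occ, ← Set.ncard_coe_finset, hO]
    congr 1
    ext p
    simp only [Finset.coe_filter, Finset.mem_range, Set.mem_ofPred_eq, ← hn]
    exact ⟨fun h => ⟨by omega, h⟩, fun h => h.2⟩
  rw [hsum, hocc, occ_block]
  -- An occurrence of `w` that begins in the last block may run into the next one, hence `N + 1`
  -- blocks.
  have hmaps : ∀ q ∈ H ×ˢ O, i q.1 + q.2 ∈ (Finset.range ((N + 1) * D + 1)).filter fun p =>
      p + z.length ≤ (N + 1) * D ∧ block x (0 + p) z.length = z := by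
    rintro ⟨j, p⟩ hq
    obtain ⟨hj, hp⟩ := Finset.mem_product.1 hq
    obtain ⟨h₁, h₂, h₃⟩ := hi j hj
    obtain ⟨-, h₄, h₅⟩ := Finset.mem_filter.1 hp
    have h₆ : (j + 1) * D ≤ N * D :=
      Nat.mul_le_mul_right D (Finset.mem_range.1 (Finset.mem_filter.1 hj).1)
    have h₇ : (N + 1) * D = N * D + D := by ring
    simp only [Finset.mem_filter, Finset.mem_range]
    refine ⟨by omega, by omega, ?_⟩
    rw [← h₃, take_drop_block x h₄] at h₅
    rw [Nat.zero_add, h₅]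
  -- A position `p` inside an occurrence that begins in block `j` satisfies jD ≤ p < (j+2)D, because
  -- n ≤ D. So `j` is p / D or p / D - 1, and `j` determines the offset.
  have hfib : ∀ p ∈ (Finset.range ((N + 1) * D + 1)).filter fun p =>
      p + z.length ≤ (N + 1) * D ∧ block x (0 + p) z.length = z,
      ((H ×ˢ O).filter fun q => i q.1 + q.2 = p).card ≤ 2 := by
    intro p _
    have hinj : Set.InjOn Prod.fst
        (((H ×ˢ O).filter fun q => i q.1 + q.2 = p : Finset (ℕ × ℕ)) : Set (ℕ × ℕ)) := by
      rintro ⟨j, k⟩ hq ⟨j', k'⟩ hq' (rfl : j = j')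
      have h₁ := (Finset.mem_filter.1 hq).2
      have h₂ := (Finset.mem_filter.1 hq').2
      simp only at h₁ h₂
      have : k = k' := by omega
      rw [this]
    rw [← Finset.card_image_of_injOn hinj]
    refine (Finset.card_le_card (t := Finset.Icc (p / D - 1) (p / D)) ?_).trans
      (by rw [Nat.card_Icc]; omega)
    intro j hj
    obtain ⟨⟨j, k⟩, hq, rfl⟩ := Finset.mem_image.1 hj
    obtain ⟨hq, h₁⟩ := Finset.mem_filter.1 hq
    obtain ⟨hj, hk⟩ := Finset.mem_product.1 hq
    obtain ⟨h₂, h₃, -⟩ := hi j hj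
    obtain ⟨-, h₄, -⟩ := Finset.mem_filter.1 hk
    simp only at h₁
    have h₅ : j ≤ p / D := (Nat.le_div_iff_mul_le (by omega)).2 (by omega)
    have h₆ : p / D < j + 2 := by
      rw [Nat.div_lt_iff_lt_mul (by omega)]
      have : (j + 2) * D = (j + 1) * D + D := by ring
      omega
    exact Finset.mem_Icc.2 ⟨by simp only; omega, h₅⟩
  have := Finset.card_le_mul_card_image_of_maps_to hmaps 2 hfib
  rw [Finset.card_product] at this
  exact_mod_cast this

/-- Divide the preceding count by `N`. By genericity the right side converges, so it is enough that
the averages exceed `δ` for infinitely many `N`. -/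
lemma mul_occ_le_of_lt_density [MeasurableSpace A] {L : ℕ} (hL : 1 ≤ L) {w : List A}
    (hw : 1 ≤ w.length) {x : ℕ → A} {ν : Measure (ℕ → A)} (hx : IsGeneric x ν) {δ : ℝ}
    (hδ : δ < density L w x) (z : List A) :
    δ * occ z w ≤ 2 * ν.real (cyl z) * (L * w.length : ℕ) := by
  set D := L * w.length with hD
  have hDpos : 0 < D := Nat.mul_pos hL hw
  have hM : Tendsto (fun N : ℕ => (N + 1) * D) atTop atTop :=
    tendsto_atTop_mono (fun N => (Nat.le_succ N).trans (Nat.le_mul_of_pos_right _ hDpos))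
      tendsto_id
  have h₁ : Tendsto (fun N : ℕ => 2 * ((occ z (block x 0 ((N + 1) * D)) : ℝ) /
      ((N + 1) * D : ℕ)) * ((1 + 1 / (N : ℝ)) * D)) atTop
      (𝓝 (2 * ν.real (cyl z) * ((1 + 0) * D))) :=
    (((hx z).comp hM).const_mul 2).mul
      ((tendsto_one_div_atTop_nhds_zero_nat.const_add 1).mul_const _)
  rw [add_zero, one_mul] at h₁
  refine ge_of_tendsto_of_frequently h₁ ?_
  refine ((frequently_lt_of_lt_density hδ).and_eventually (eventually_gt_atTop 0)).mono ?_
  rintro N ⟨hN, hN0⟩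
  have hN0' : (0 : ℝ) < N := by exact_mod_cast hN0
  have hD' : (0 : ℝ) < D := by exact_mod_cast hDpos
  have h₂ := sum_blockIndicator_mul_occ_le hL hw z x N
  rw [← hD] at h₂
  rw [lt_div_iff₀ hN0'] at hN
  have h₃ : δ * N * occ z w ≤ 2 * (occ z (block x 0 ((N + 1) * D)) : ℝ) :=
    (mul_le_mul_of_nonneg_right hN.le (Nat.cast_nonneg _)).trans h₂
  have h₄ : 2 * ((occ z (block x 0 ((N + 1) * D)) : ℝ) / ((N + 1) * D : ℕ)) *
      ((1 + 1 / (N : ℝ)) * D) = 2 * (occ z (block x 0 ((N + 1) * D)) : ℝ) / N := by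
    push_cast
    field_simp
  rw [h₄, le_div_iff₀ hN0']
  linarith

end Density

/-! ### Domination on cylinders and identification of the generated measure -/

section Measures

lemma cyl_nil {A : Type u} : cyl ([] : List A) = Set.univ := by
  ext x
  simp [cyl, block]

variable {A : Type u} [MeasurableSpace A]

lemma measurableSet_setOf_block_eq [DiscreteMeasurableSpace A] (n : ℕ) (w : List A) :
    MeasurableSet {x : ℕ → A | block x 0 n = w} := by
  by_cases hw : w.length = n
  · subst hw
    have : {x : ℕ → A | block x 0 w.length = w} =
        ⋂ k : Fin w.length, (fun x : ℕ → A => x k) ⁻¹' {w.get k} := by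
      ext x
      simp only [Set.mem_ofPred_eq, Set.mem_iInter, Set.mem_preimage, Set.mem_singleton_iff]
      constructor
      · intro h k
        simpa [block] using List.getElem_of_eq h (i := k) (by simp)
      · intro h
        refine List.ext_getElem (length_block x 0 _) fun k _ hk => ?_
        simpa [block] using h ⟨k, hk⟩
    rw [this]
    exact MeasurableSet.iInter fun k => measurable_pi_apply _ (MeasurableSet.of_discrete)
  · convert MeasurableSet.empty
    ext x
    simp only [Set.mem_ofPred_eq, Set.mem_empty_iff_false, iff_false]
    rintro rfl
    exact hw (length_block x 0 n)

/-- Domination of measures on sequences can be checked on cylinders. -/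
lemma measure_le_of_cyl_le [Finite A] [TopologicalSpace A] [DiscreteTopology A]
    [DiscreteMeasurableSpace A] {μ ν : Measure (ℕ → A)} [IsFiniteMeasure ν]
    (h : ∀ z : List A, μ (cyl z) ≤ ν (cyl z)) : μ ≤ ν := by
  have hopen : ∀ U : Set (ℕ → A), IsOpen U → μ U ≤ ν U := by
    intro U hU
    -- An open set is the increasing union over `n` of the finitely many disjoint cylinders of
    -- length `n` that it contains.
    set T : ℕ → Set (List A) := fun n =>
      {w | w.length = n ∧ cyl w ⊆ U} with hT
    set V : ℕ → Set (ℕ → A) := fun n => ⋃ w ∈ T n, cyl w with hV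
    have hTfin : ∀ n, (T n).Finite := fun n =>
      (List.finite_length_eq A n).subset fun _ hw => hw.1
    have hdisj : ∀ n, (T n).PairwiseDisjoint (cyl : List A → Set (ℕ → A)) := by
      intro n w hw w' hw' hne
      refine Set.disjoint_left.2 fun x hx hx' => hne ?_
      have h₁ : block x 0 w.length = w := hx
      have h₂ : block x 0 w'.length = w' := hx'
      rw [← h₁, ← h₂, hw.1, hw'.1]
    have hmono : Monotone V := by
      intro m n hmn x hx
      simp only [hV, hT, Set.mem_iUnion, Set.mem_ofPred_eq] at hx ⊢
      obtain ⟨w, ⟨rfl, hwU⟩, hxw⟩ := hx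
      have hxw' : block x 0 w.length = w := hxw
      refine ⟨block x 0 n, ⟨length_block x 0 n, fun y hy => hwU ?_⟩, ?_⟩
      · have hy' : block y 0 n = block x 0 n := by
          have : block y 0 (block x 0 n).length = block x 0 n := hy
          rwa [length_block] at this
        show block y 0 w.length = w
        rw [← hxw', length_block]
        rw [block_eq_iff] at hy' ⊢
        exact fun k hk => hy' k (hk.trans_le hmn)
      · show block x 0 (block x 0 n).length = block x 0 n
        rw [length_block]
    have hUV : U = ⋃ n, V n := by
      refine Set.Subset.antisymm (fun x hx => ?_) ?_
      · obtain ⟨s, ⟨y, n, rfl⟩, hxy, hyU⟩ :=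
          (PiNat.isTopologicalBasis_cylinders (fun _ : ℕ => A)).exists_subset_of_mem_open hx hU
        refine Set.mem_iUnion.2 ⟨n, Set.mem_iUnion₂.2 ⟨block x 0 n,
          ⟨length_block x 0 n, fun x' hx' => hyU ?_⟩, ?_⟩⟩
        · have hx'' : block x' 0 (block x 0 n).length = block x 0 n := hx'
          rw [length_block, block_eq_iff] at hx''
          intro k hk
          have := hx'' k hk
          rw [Nat.zero_add] at this
          rw [this]
          exact hxy k hk
        · show block x 0 (block x 0 n).length = block x 0 n
          rw [length_block]
      · exact Set.iUnion_subset fun n => Set.iUnion₂_subset fun w hw => hw.2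
    rw [hUV, hmono.measure_iUnion, hmono.measure_iUnion]
    refine iSup_mono fun n => ?_
    rw [measure_biUnion (hTfin n).countable (hdisj n)
        (fun w _ => measurableSet_setOf_block_eq w.length w),
      measure_biUnion (hTfin n).countable (hdisj n)
        (fun w _ => measurableSet_setOf_block_eq w.length w)]
    exact ENNReal.tsum_le_tsum fun w => h w
  have : BorelSpace A := ⟨by
    rw [borel_eq_top_of_discrete]
    exact MeasurableSpace.ext fun s => ⟨fun _ => trivial, fun _ => MeasurableSet.of_discrete⟩⟩
  refine Measure.le_intro fun s _ _ => ?_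
  -- Outer regularity of the finite measure `ν` passes from open sets to all sets.
  rw [s.measure_eq_iInf_isOpen ν]
  exact le_iInf₂ fun U hsU => le_iInf fun hU => (measure_mono hsU).trans (hopen U hU)

/-- The empty word occurs n + 1 times in a word of length n, and (n + 1) / n tends to 1. Since
`Measure.real` is 0 where a measure is infinite, this also rules out infinite mass. -/
lemma Generates.isProbabilityMeasure {ι : Type*} {l : Filter ι} [l.NeBot] {w : ι → List A}
    {μ : Measure (ℕ → A)} (h : Generates l w μ)
    (hw : Tendsto (fun i => (w i).length) l atTop) : IsProbabilityMeasure μ := by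
  have h₁ := h.2 []
  rw [cyl_nil] at h₁
  have h₂ : Tendsto (fun i => (1 : ℝ) + 1 / ((w i).length : ℝ)) l (𝓝 (1 + 0)) :=
    (tendsto_one_div_atTop_nhds_zero_nat.comp hw).const_add 1
  have h₃ : μ.real Set.univ = 1 := by
    rw [add_zero] at h₂
    refine tendsto_nhds_unique h₁ (h₂.congr' ?_)
    filter_upwards [hw.eventually (eventually_gt_atTop 0)] with i hi
    have : (0 : ℝ) < (w i).length := by exact_mod_cast hi
    rw [occ_nil]
    push_cast
    field_simp
  refine ⟨?_⟩
  rw [Measure.real, ENNReal.toReal_eq_one_iff] at h₃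
  exact h₃

/-- If the words that generate `μ` have upper densities bounded away from `0` in a generic point
of the ergodic measure `ν`, then `μ = ν`. -/
lemma Generates.eq_of_frequently_lt_density [Finite A] [TopologicalSpace A] [DiscreteTopology A]
    [DiscreteMeasurableSpace A] {ι : Type*} {l : Filter ι} [l.NeBot] {w : ι → List A}
    {μ ν : Measure (ℕ → A)} (h : Generates l w μ)
    (hw : Tendsto (fun i => (w i).length) l atTop) [IsProbabilityMeasure ν] (hν : Ergodic shift ν)
    {x : ℕ → A} (hx : IsGeneric x ν) {L : ℕ} (hL : 1 ≤ L) {δ : ℝ} (hδ : 0 < δ)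
    (hd : ∃ᶠ i in l, δ < density L (w i) x) : μ = ν := by
  have := h.isProbabilityMeasure hw
  -- The 2 accounts for overlapping occurrences, the L for the block length, and the 1/δ for the
  -- proportion of blocks that see the word.
  have hcyl : ∀ z, μ.real (cyl z) ≤ 2 * L / δ * ν.real (cyl z) := by
    intro z
    refine le_of_tendsto_of_frequently (h.2 z) ?_
    refine (hd.and_eventually (hw.eventually (eventually_ge_atTop 1))).mono ?_
    rintro i ⟨hi, hwi⟩
    have h₁ := mul_occ_le_of_lt_density hL hwi hx hi z
    have h₂ : (0 : ℝ) < (w i).length := by exact_mod_cast hwi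
    rw [div_le_iff₀ h₂]
    have h₃ : 2 * (L : ℝ) / δ * ν.real (cyl z) * (w i).length =
        2 * ν.real (cyl z) * (L * (w i).length : ℕ) / δ := by
      push_cast; ring
    rw [h₃, le_div_iff₀ hδ]
    linarith
  set c : NNReal := (2 * L / δ).toNNReal
  have hle : μ ≤ c • ν := by
    refine measure_le_of_cyl_le fun z => ?_
    have hc : ((c • ν).real (cyl z)) = 2 * L / δ * ν.real (cyl z) := by
      rw [measureReal_nnreal_smul_apply, Real.coe_toNNReal _ (by positivity)]
    have := hcyl z
    rw [← hc] at this
    exact (ENNReal.toReal_le_toReal (measure_ne_top _ _) (measure_ne_top _ _)).1 this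
  -- An invariant probability measure absolutely continuous with respect to an ergodic one equals
  -- it.
  have hac : μ ≪ ν := hle.absolutelyContinuous.trans Measure.smul_absolutelyContinuous
  exact hν.eq_of_absolutelyContinuous h.1 hac

end Measures

/-! ### Vertices of Λ and the measures that color them -/

namespace ColoringData

variable {A : Type u} [MeasurableSpace A] {Ω : Set (ℕ → A)} (S : ColoringData.{u, v} Ω)

/-- The naming of the vertices of the special Rauzy graph of words of length `n`. -/
def vertexEquiv (n : S.J) : S.Λ.V ≃ SpecialVertex Ω n := (S.iso n).vert

lemma wordAt_eq (w : S.Λ.V) (n : S.J) : S.wordAt w n = (S.vertexEquiv n w).word := rfl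

lemma nonempty_J : Nonempty S.J := S.J_infinite.nonempty.to_subtype

lemma tendsto_val_J : Tendsto (Subtype.val : S.J → ℕ) atTop atTop := by
  have := S.nonempty_J
  refine tendsto_atTop_atTop_of_monotone (fun _ _ h => h) fun b => ?_
  obtain ⟨a, ha, hb⟩ := S.J_infinite.exists_gt b
  exact ⟨⟨a, ha⟩, hb.le⟩

lemma wordAt_mem_words (w : S.Λ.V) (n : S.J) : S.wordAt w n ∈ words Ω n := by
  rw [wordAt_eq]
  rcases S.vertexEquiv n w with v | v
  · exact v.2.1
  · exact v.2.1

lemma length_wordAt (w : S.Λ.V) (n : S.J) : (S.wordAt w n).length = n :=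
  (S.wordAt_mem_words w n).2

lemma tendsto_length_wordAt (w : S.Λ.V) :
    Tendsto (fun n => (S.wordAt w n).length) atTop atTop := by
  simpa only [S.length_wordAt] using S.tendsto_val_J

/-- A measure that colors a vertex is the measure generated by that vertex. -/
lemma μ_eq_of_mem_colorClass [Finite A] [TopologicalSpace A] [DiscreteTopology A]
    [DiscreteMeasurableSpace A] {L : ℕ} (hL : 1 ≤ L) {x : Measure (ℕ → A) → ℕ → A}
    {ν : Measure (ℕ → A)} (hν : ν ∈ ergodicMeasures Ω) (hx : IsGeneric (x ν) ν) {w : S.Λ.V}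
    (hw : w ∈ S.colorClass L x ν) : S.μ w = ν := by
  have := S.nonempty_J
  have := hν.1.1
  have hpos : 0 < S.vertexDensity L w (x ν) := hw
  refine (S.generates w).eq_of_frequently_lt_density (S.tendsto_length_wordAt w) hν.2 hx hL
    (half_pos hpos) ?_
  exact frequently_lt_of_lt_limsup
    (isCoboundedUnder_le_of_mem_Icc fun _ => density_mem_Icc L _ (x ν)) (half_lt_self hpos)

lemma mem_colorClass_of_frequently {L : ℕ} {x : Measure (ℕ → A) → ℕ → A} {ν : Measure (ℕ → A)}
    {w : S.Λ.V} {c : ℝ} (hc : 0 < c) (h : ∃ᶠ n in atTop, c ≤ density L (S.wordAt w n) (x ν)) :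
    w ∈ S.colorClass L x ν :=
  hc.trans_le (le_limsup_of_frequently_le h
    (isBoundedUnder_le_of_mem_Icc fun _ => density_mem_Icc L _ (x ν)))

/-- A single n > N₀ in J suffices: the vertices correspond to the left special words together with
the right special words of length n. -/
lemma finite_and_card_vertices_le [Finite A] [TopologicalSpace A] [DiscreteTopology A]
    (hΩ : IsMinimalShift Ω) {K N₀ : ℕ} (hK : HasConstantGrowth Ω K N₀) :
    Finite S.Λ.V ∧ Nat.card S.Λ.V ≤ 2 * K := by
  obtain ⟨n, hn, hn₀⟩ := S.J_infinite.exists_gt N₀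
  have : Finite {w // w ∈ leftSpecial Ω n} := finite_leftSpecial Ω n
  have : Finite {w // w ∈ rightSpecial Ω n} := finite_rightSpecial Ω n
  let e := S.vertexEquiv ⟨n, hn⟩
  refine ⟨Finite.of_equiv _ e.symm, ?_⟩
  rw [Nat.card_congr e, Nat.card_sum]
  have h₁ := hK.ncard_leftSpecial_le hΩ hn₀.le
  have h₂ := hK.ncard_rightSpecial_le hn₀.le
  rw [← Nat.card_coe_set_eq] at h₁ h₂
  exact (add_le_add h₁ h₂).trans_eq (two_mul K).symm

end ColoringData

/-- If each block of a point sees a word of a finite family, then some word of the family has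
upper density at least the inverse of the size of the family. -/
lemma exists_inv_le_density {A : Type u} {ι : Type*} [Fintype ι] {L n : ℕ} {w : ι → List A}
    (hw : ∀ i, (w i).length = n) {x : ℕ → A}
    (h : ∀ m, ∃ k, m ≤ k ∧ k < m + L * n ∧ ∃ i, block x k n = w i) :
    ∃ i, (Fintype.card ι : ℝ)⁻¹ ≤ density L (w i) x := by
  have hι : Nonempty ι := by
    obtain ⟨_, _, _, i, _⟩ := h 0
    exact ⟨i⟩
  have hcard : (0 : ℝ) < Fintype.card ι := by exact_mod_cast Fintype.card_pos
  by_contra! hcon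
  have hev : ∀ i, ∀ᶠ N : ℕ in atTop,
      (∑ j ∈ Finset.range N, blockIndicator L (w i) x j) / (N : ℝ) < (Fintype.card ι : ℝ)⁻¹ := by
    intro i
    by_contra hi
    rw [not_eventually] at hi
    exact (hcon i).not_ge (le_density (hi.mono fun N hN => not_lt.1 hN))
  obtain ⟨N, hN, hN0⟩ := ((eventually_all.2 hev).and (eventually_gt_atTop 0)).exists
  have hN0' : (0 : ℝ) < N := by exact_mod_cast hN0
  -- Each of the first `N` blocks is counted by at least one member of the family.
  have h₁ : (N : ℝ) ≤ ∑ i, ∑ j ∈ Finset.range N, blockIndicator L (w i) x j := by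
    rw [Finset.sum_comm]
    calc (N : ℝ) = ∑ j ∈ Finset.range N, (1 : ℝ) := by simp
      _ ≤ _ := Finset.sum_le_sum fun j _ => ?_
    obtain ⟨k, hjk, hk, i, hi⟩ := h (j * (L * n))
    have h₂ : blockIndicator L (w i) x j = 1 := by
      rw [blockIndicator, if_pos]
      rw [hw]
      exact ⟨k, hjk, by rw [Nat.add_mul, Nat.one_mul]; exact hk, hi⟩
    rw [← h₂]
    exact Finset.single_le_sum (f := fun i => blockIndicator L (w i) x j)
      (fun i _ => blockIndicator_nonneg L (w i) x j) (Finset.mem_univ i)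
  have h₃ : ∑ i, ∑ j ∈ Finset.range N, blockIndicator L (w i) x j <
      ∑ _i : ι, (Fintype.card ι : ℝ)⁻¹ * N :=
    Finset.sum_lt_sum_of_nonempty Finset.univ_nonempty fun i _ => (div_lt_iff₀ hN0').1 (hN i)
  rw [Finset.sum_const, Finset.card_univ, nsmul_eq_mul, mul_inv_cancel_left₀ hcard.ne'] at h₃
  linarith

/-! ### Each ergodic measure colors two vertices -/

namespace ColoringData

variable {A : Type u} [MeasurableSpace A] {Ω : Set (ℕ → A)} (S : ColoringData.{u, v} Ω)

/-- If each block of `x` sees a word of `B` and the words of `B` are named by vertices, then one of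
these vertices names a word whose upper density is bounded below. -/
lemma exists_vertex_inv_le_density [Fintype S.Λ.V] {n : S.J} {L : ℕ} {x : ℕ → A}
    {B : Set (List A)} (p : B → SpecialVertex Ω n) (hp : ∀ b, (p b).word = b)
    (h : ∀ m, ∃ k, m ≤ k ∧ k < m + L * n ∧ block x k n ∈ B) :
    ∃ v, S.vertexEquiv n v ∈ Set.range p ∧
      (Fintype.card S.Λ.V : ℝ)⁻¹ ≤ density L (S.wordAt v n) x := by
  classical
  obtain ⟨⟨v, hv⟩, h₁⟩ := exists_inv_le_density
    (ι := {v : S.Λ.V // S.vertexEquiv n v ∈ Set.range p}) (w := fun v => S.wordAt v.1 n) (L := L)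
    (n := n) (x := x) (fun v => S.length_wordAt v.1 n) (fun m => by
      obtain ⟨k, h₁, h₂, h₃⟩ := h m
      refine ⟨k, h₁, h₂, ⟨(S.vertexEquiv n).symm (p ⟨_, h₃⟩), by simp⟩, ?_⟩
      rw [wordAt_eq, Equiv.apply_symm_apply, hp])
  -- Passing to the number of all vertices makes the bound independent of `n`.
  refine ⟨v, hv, le_trans ?_ h₁⟩
  have hpos : 0 < Fintype.card {v : S.Λ.V // S.vertexEquiv n v ∈ Set.range p} :=
    Fintype.card_pos_iff.2 ⟨⟨v, hv⟩⟩
  refine inv_anti₀ (by exact_mod_cast hpos) ?_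
  exact_mod_cast Fintype.card_subtype_le _

variable [Finite A] [TopologicalSpace A] [DiscreteTopology A]

/-- Each ergodic measure colors at least two vertices, one of which names left special words and
one of which names right special words infinitely often. -/
lemma two_le_encard_colorClass (hΩ : IsMinimalShift Ω) {K N₀ : ℕ}
    (hK : HasConstantGrowth Ω K N₀) {x : Measure (ℕ → A) → ℕ → A} {ν : Measure (ℕ → A)}
    (hx : x ν ∈ Ω) : 2 ≤ (S.colorClass (K + 1) x ν).encard := by
  have := S.nonempty_J
  have := (S.finite_and_card_vertices_le hΩ hK).1
  have := Fintype.ofFinite S.Λ.V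
  set c : ℝ := (Fintype.card S.Λ.V : ℝ)⁻¹ with hc
  have hev : ∀ᶠ n : S.J in atTop, ∃ q : S.Λ.V × S.Λ.V, q.1 ≠ q.2 ∧
      c ≤ density (K + 1) (S.wordAt q.1 n) (x ν) ∧
      c ≤ density (K + 1) (S.wordAt q.2 n) (x ν) := by
    filter_upwards [S.tendsto_val_J.eventually (eventually_ge_atTop N₀),
      S.tendsto_val_J.eventually hK.eventually_complexity_lt] with n hn₀ hn
    -- Using `Sum.inl` here and `Sum.inr` below keeps the two vertices distinct even if both belong
    -- to the same bispecial word.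
    obtain ⟨v, ⟨a, ha⟩, hv⟩ := S.exists_vertex_inv_le_density (n := n) (L := K + 1)
      (B := leftSpecial Ω n) Sum.inl (fun _ => rfl)
      (exists_block_mem_leftSpecial hΩ hx (hK.leftSpecial_nonempty hn₀) hn)
    obtain ⟨v', ⟨b, hb⟩, hv'⟩ := S.exists_vertex_inv_le_density (n := n) (L := K + 1)
      (B := rightSpecial Ω n) Sum.inr (fun _ => rfl)
      (exists_block_mem_rightSpecial hΩ hx (hK.rightSpecial_nonempty hn₀) hn)
    refine ⟨(v, v'), fun h => ?_, hv, hv'⟩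
    have h' : v = v' := h
    rw [← h', ← ha] at hb
    exact Sum.inr_ne_inl hb
  -- There are finitely many pairs of vertices, so one pair serves infinitely many `n`.
  obtain ⟨⟨v, v'⟩, hq⟩ : ∃ q : S.Λ.V × S.Λ.V, ∃ᶠ n : S.J in atTop, q.1 ≠ q.2 ∧
      c ≤ density (K + 1) (S.wordAt q.1 n) (x ν) ∧
      c ≤ density (K + 1) (S.wordAt q.2 n) (x ν) := by
    by_contra hcon
    simp only [not_exists, not_frequently] at hcon
    obtain ⟨n, h₁, q, h₂⟩ := ((eventually_all.2 hcon).and hev).exists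
    exact h₁ q h₂
  obtain ⟨n, hne, -, -⟩ := hq.exists
  have hcpos : 0 < c := inv_pos.2 (by exact_mod_cast Fintype.card_pos_iff.2 ⟨v⟩)
  exact two_le_encard (S.mem_colorClass_of_frequently hcpos (hq.mono fun n h => h.2.1))
    (S.mem_colorClass_of_frequently hcpos (hq.mono fun n h => h.2.2)) hne

end ColoringData

end SpecialRauzy

/-! ### The final count -/

theorem corollary4p7 {A : Type*} [Finite A] [TopologicalSpace A] [DiscreteTopology A]
    [MeasurableSpace A] [DiscreteMeasurableSpace A]
    (Ω : Set (ℕ → A)) (hmin : IsMinimalShift Ω) (haper : IsAperiodic Ω)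
    (K N₀ : ℕ) (hK : HasConstantGrowth Ω K N₀)
    (S : ColoringData Ω)
    (x : Measure (ℕ → A) → ℕ → A)
    (hx : ∀ ν ∈ ergodicMeasures Ω, x ν ∈ Ω ∧ IsGeneric (x ν) ν)
    (h : (∃ ν ∈ ergodicMeasures Ω, 4 < (S.colorClass (K + 1) x ν).encard) ∨
      3 ≤ (S.uncolored (K + 1) x).encard) :
    (ergodicMeasures Ω).encard + 2 ≤ (K : ℕ∞) := by
  classical
  obtain ⟨hfin, hcard⟩ := S.finite_and_card_vertices_le hmin hK
  have := Fintype.ofFinite S.Λ.V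
  have hμ : ∀ ν ∈ ergodicMeasures Ω, ∀ w ∈ S.colorClass (K + 1) x ν, S.μ w = ν :=
    fun ν hν w hw => S.μ_eq_of_mem_colorClass (by omega) hν (hx ν hν).2 hw
  have htwo : ∀ ν ∈ ergodicMeasures Ω, 2 ≤ (S.colorClass (K + 1) x ν).encard :=
    fun ν hν => S.two_le_encard_colorClass hmin hK (hx ν hν).1
  have hE : (ergodicMeasures Ω).Finite := by
    refine (Set.finite_range S.μ).subset fun ν hν => ?_
    obtain ⟨w, hw⟩ := Set.encard_pos.1 (zero_lt_two.trans_le (htwo ν hν))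
    exact ⟨w, hμ ν hν w hw⟩
  set E := hE.toFinset with hEdef
  set c : Measure (ℕ → A) → Finset S.Λ.V := fun ν => (S.colorClass (K + 1) x ν).toFinset with hc
  have hcE : ∀ ν, (S.colorClass (K + 1) x ν).encard = (c ν).card := fun ν => by
    rw [← Set.encard_coe_eq_coe_finsetCard, hc, Set.coe_toFinset]
  have htwo' : ∀ ν ∈ E, 2 ≤ (c ν).card := fun ν hν => by
    have := htwo ν (hE.mem_toFinset.1 hν)
    rw [hcE] at this
    exact_mod_cast this
  have hdisj : (E : Set (Measure (ℕ → A))).PairwiseDisjoint c := by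
    intro ν hν ν' hν' hne
    refine Finset.disjoint_left.2 fun w hw hw' => hne ?_
    rw [← hμ ν (hE.mem_toFinset.1 hν) w (Set.mem_toFinset.1 hw),
      hμ ν' (hE.mem_toFinset.1 hν') w (Set.mem_toFinset.1 hw')]
  have hunc : Disjoint (E.biUnion c) (S.uncolored (K + 1) x).toFinset := by
    refine Finset.disjoint_left.2 fun w hw hw' => ?_
    obtain ⟨ν, hν, hwν⟩ := Finset.mem_biUnion.1 hw
    exact Set.mem_toFinset.1 hw' ν (hE.mem_toFinset.1 hν) (Set.mem_toFinset.1 hwν)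
  have htotal : ∑ ν ∈ E, (c ν).card + (S.uncolored (K + 1) x).toFinset.card ≤ 2 * K := by
    rw [← Finset.card_biUnion hdisj, ← Finset.card_union_of_disjoint hunc]
    refine (Finset.card_le_univ _).trans ?_
    rwa [← Nat.card_eq_fintype_card]
  have hsum : ∀ F ⊆ E, F.card * 2 ≤ ∑ ν ∈ F, (c ν).card := fun F hF => by
    rw [← smul_eq_mul]
    exact Finset.card_nsmul_le_sum F _ 2 fun ν hν => htwo' ν (hF hν)
  -- The count reads 5 + 2(#E - 1) ≤ 2K in the first case and 2 #E + 3 ≤ 2K in the second. Both give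
  -- 2 #E + 3 ≤ 2K, and parity improves the 3 to 4.
  have hmain : E.card + 2 ≤ K := by
    rcases h with ⟨ν, hν, h₄⟩ | h₃
    · have hνE : ν ∈ E := hE.mem_toFinset.2 hν
      rw [hcE] at h₄
      have h₄' : 4 < (c ν).card := by exact_mod_cast h₄
      have h₅ := hsum (E.erase ν) (Finset.erase_subset ν E)
      have h₆ := Finset.add_sum_erase E (fun ν => (c ν).card) hνE
      have h₇ := Finset.card_erase_add_one hνE
      omega
    · rw [← Set.coe_toFinset (S.uncolored (K + 1) x), Set.encard_coe_eq_coe_finsetCard] at h₃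
      have h₃' : 3 ≤ (S.uncolored (K + 1) x).toFinset.card := by exact_mod_cast h₃
      have := hsum E subset_rfl
      omega
  rw [hE.encard_eq_coe_toFinset_card]
  exact_mod_cast hmain
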